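/- Let $\mathcal G$ be a maximal ancestral graph (MAG) on a finite vertex set $\mathcal V=[n]$ whose numerical order is topological: $w\in\mathrm{an}(v)$ implies $w\le v$. Write $\mathrm{pa},\mathrm{ch},\mathrm{sib},\mathrm{an},\mathrm{de}$ for parents, children, siblings ($\leftrightarrow$), ancestors and descendants (the last two containing the vertex itself), $\mathcal G_W$ for the induced subgraph on $W$, and $\mathrm{dis}_W(S)$ for the set of vertices joined to $S$ by bidirected paths in $\mathcal G_W$. *Notation.* A set $A$ is ancestral if $\mathrm{an}(A)=A$. For $v\in A$ with $\mathrm{ch}(v)\cap A=\emptyset$, put $\mathrm{mb}(v,A)=(\mathrm{pa}_{\mathcal G_A}(\mathrm{dis}_A(v))\cup\mathrm{dis}_A(v))\setminus\{v\}$. The ordered local Markov property is the list of the independences $v\perp A\setminus(\mathrm{mb}(v,A)\cup\{v\})\mid \mathrm{mb}(v,A)$, for all ancestral $A$ and all childless $v$ in $A$. Let $\mathrm{barren}(W)=\{w\in W:\mathrm{de}(w)\cap W=\{w\}\}$. A head is a nonempty set $H$ with $\mathrm{barren}(H)=H$ that lies in a single district of $\mathcal G_{\mathrm{an}(H)}$.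 With $D_H=\mathrm{dis}_{\mathrm{an}(H)}(H)$, its tail is $\mathrm{tail}(H)=(D_H\setminus H)\cup\mathrm{pa}(D_H)$, and $\mathrm{ham}(H)=\mathrm{sib}(D_H)\setminus D_H$. Let $\lceil W\rceil=\{w\in W: W\cap\mathrm{an}(w)=\{w\}\}$. For each $i$ let $\mathcal H_i$ be the set of heads whose largest vertex is $i$, ordered by $H\le H'\iff\mathrm{an}(H)\subseteq\mathrm{an}(H')$. For $H,H'\in\mathcal H_i$ and $k\in H\setminus\{i\}$, write $H\to^k H'$ if, in $\mathcal G'=\mathcal G_{\mathrm{an}(H)\setminus\{k\}}$, $\mathrm{barren}_{\mathcal G'}(\mathrm{dis}_{\mathcal G'}(i))=H'$. The refined power DAG for $i$ has, for every $H'\in\mathcal H_i$ other than the maximal element of $\mathcal H_i$, the edge $H^*\to^k H'$ with $k=\min\lceil\mathrm{ham}(H')\rceil$ and $H^*=\max\{H\in\mathcal H_i:H\to^k H'\}$. The associated independence is $$i\perp (H^*\cup \mathrm{tail}(H^*))\setminus(H'\cup \mathrm{tail}(H')\cup\{k\})\mid (H'\cup \mathrm{tail}(H'))\setminus\{i\}.$$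 The list $\tilde{\mathbb L}^{\mathcal G}_i$ consists of $i\perp[i-1]\setminus\mathrm{mb}(i,[i])\mid\mathrm{mb}(i,[i])$ and of the independences associated with the edges of the refined power DAG for $i$; and $\tilde{\mathbb L}^{\mathcal G}=\bigcup_i\tilde{\mathbb L}^{\mathcal G}_i$. **Proposition.** The list $\tilde{\mathbb L}^{\mathcal G}$ is equivalent to the ordered local Markov property: random variables $(X_v)_{v\in\mathcal V}$ satisfy all the independences of $\tilde{\mathbb L}^{\mathcal G}$ under a probability distribution if and only if they satisfy the ordered local Markov property; and, more generally, a semi-graphoid contains one list if and only if it contains the other. Here a semi-graphoid is a set of triples satisfying triviality ($A\perp\emptyset\mid C$), symmetry, decomposition, weak union and contraction on pairwise disjoint sets. Moreover, for every $i$ and every non-maximal $H'\in\mathcal H_i$ there is exactly one edge $H^*\to^k H'$ as above, and the number of independences in $\tilde{\mathbb L}^{\mathcal G}$ is at most the number of heads of $\mathcal G$. -/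

import Mathlib

open MeasureTheory ProbabilityTheory Set

/-- A graph with directed edges (`G.dir a b` is `a → b`) and bidirected edges
(`G.bi a b` is `a ↔ b`), every edge joining two distinct vertices. -/
structure MixedGraph (V : Type*) where
  dir : V → V → Prop
  bi : V → V → Prop
  bi_symm : ∀ a b, bi a b → bi b a
  dir_irrefl : ∀ a, ¬ dir a a
  bi_irrefl : ∀ a, ¬ bi a a

/-- The three ways in which an edge can be traversed: `a → b`, `a ← b`, `a ↔ b`. -/
inductive EdgeKind
  | fwd
  | bwd
  | bidir

namespace MixedGraph

variable {V : Type*} (G : MixedGraph V)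

/-! ### Parents, siblings, ancestors, descendants, districts -/

def pa (W : Set V) : Set V := {w | ∃ v ∈ W, G.dir w v}

def ch (W : Set V) : Set V := {w | ∃ v ∈ W, G.dir v w}

def sib (W : Set V) : Set V := {w | ∃ v ∈ W, G.bi w v}

def an (W : Set V) : Set V := {w | ∃ v ∈ W, Relation.ReflTransGen G.dir w v}

def de (W : Set V) : Set V := {w | ∃ v ∈ W, Relation.ReflTransGen G.dir v w}

def dis (W : Set V) : Set V := {w | ∃ v ∈ W, Relation.ReflTransGen G.bi w v}

/-- The induced subgraph `G_W`.  It is carried by the same type of vertices, only the edges with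
both endpoints in `W` being kept; the operators above, applied to subsets of `W`, then return
subsets of `W` and have the same values as in the graph with vertex set `W`. -/
def induced (W : Set V) : MixedGraph V where
  dir a b := a ∈ W ∧ b ∈ W ∧ G.dir a b
  bi a b := a ∈ W ∧ b ∈ W ∧ G.bi a b
  bi_symm := fun a b h => ⟨h.2.1, h.1, G.bi_symm a b h.2.2⟩
  dir_irrefl := fun a h => G.dir_irrefl a h.2.2
  bi_irrefl := fun a h => G.bi_irrefl a h.2.2

/-- The district in the induced subgraph `G_W`. -/
def disIn (W S : Set V) : Set V := (G.induced W).dis S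

/-! ### m-separation and maximal ancestral graphs -/

def Adjacent (a b : V) : Prop := G.dir a b ∨ G.dir b a ∨ G.bi a b

def HasEdge : EdgeKind → V → V → Prop
  | .fwd, a, b => G.dir a b
  | .bwd, a, b => G.dir b a
  | .bidir, a, b => G.bi a b

/-- The path `p 0, …, p k` of distinct vertices, with edge `e j` between `p j` and `p (j+1)`. -/
def IsPath (k : ℕ) (p : ℕ → V) (e : ℕ → EdgeKind) : Prop :=
  InjOn p (Iic k) ∧ ∀ j < k, G.HasEdge (e j) (p j) (p (j + 1))

/-- The nonendpoint `p (j+1)` is a collider: the edges on both sides have an arrowhead at it. -/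
def IsCollider (e : ℕ → EdgeKind) (j : ℕ) : Prop :=
  e j ≠ .bwd ∧ e (j + 1) ≠ .fwd

/-- There is an m-connecting path between `a` and `b` given `C`. -/
def MConnected (a b : V) (C : Set V) : Prop :=
  ∃ (k : ℕ) (p : ℕ → V) (e : ℕ → EdgeKind),
    G.IsPath k p e ∧ p 0 = a ∧ p k = b ∧
    ∀ j, j + 1 < k →
      (IsCollider e j → p (j + 1) ∈ G.an C) ∧ (¬ IsCollider e j → p (j + 1) ∉ C)

/-- `G` has no directed cycle (only directed and bidirected edges are present by design). -/
def IsADMG : Prop := ∀ v, ¬ Relation.TransGen G.dir v v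

/-- Maximal ancestral graphs. -/
structure IsMAG : Prop where
  acyclic : G.IsADMG
  maximal : ∀ a b, a ≠ b → ¬ G.Adjacent a b →
    ∃ C : Set V, a ∉ C ∧ b ∉ C ∧ ¬ G.MConnected a b C
  ancestral : ∀ v, G.sib {v} ∩ G.an {v} = ∅

/-! ### Heads, tails, Markov blankets -/

def barren (W : Set V) : Set V := {w ∈ W | G.de {w} ∩ W = {w}}

/-- `H` is a head: it is barren and contained in a single district of `G_{an(H)}`.  (The empty set
is not a head, since the empty graph has no district.) -/
def IsHead (H : Set V) : Prop :=
  G.barren H = H ∧ ∃ v ∈ G.an H, H ⊆ G.disIn (G.an H) {v}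

def heads : Set (Set V) := {H | G.IsHead H}

def tail (H : Set V) : Set V :=
  (G.disIn (G.an H) H \ H) ∪ G.pa (G.disIn (G.an H) H)

def IsAncestral (A : Set V) : Prop := G.an A = A

/-- The Markov blanket of `v` in the ancestral set `A`. -/
def mb (v : V) (A : Set V) : Set V :=
  ((G.induced A).pa (G.disIn A {v}) ∪ G.disIn A {v}) \ {v}

def ceil (W : Set V) : Set V := {w ∈ W | W ∩ G.an {w} = {w}}

def ham (H : Set V) : Set V := G.sib (G.disIn (G.an H) H) \ G.disIn (G.an H) H

end MixedGraph

/-! ### Independence statements -/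

/-- The formal statement that `left` is independent of `right` given `given`. -/
@[ext]
structure CIStatement (V : Type*) where
  left : Set V
  right : Set V
  given : Set V

section Independence

variable {V : Type*}

/-- The sigma-algebra generated by the variables `X v`, `v ∈ A`. -/
abbrev sigmaOf {Ω : Type*} {E : V → Type*} [∀ v, MeasurableSpace (E v)]
    (X : ∀ v, Ω → E v) (A : Set V) : MeasurableSpace Ω :=
  ⨆ v ∈ A, MeasurableSpace.comap (X v) inferInstance

/-- `X_A` and `X_B` are conditionally independent given `X_C` under `P`. -/
def CondIndepVars {Ω : Type*} [MeasurableSpace Ω] (P : Measure Ω)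
    {E : V → Type*} [∀ v, MeasurableSpace (E v)] (X : ∀ v, Ω → E v) (A B C : Set V) : Prop :=
  ∀ s t : Set Ω, MeasurableSet[sigmaOf X A] s → MeasurableSet[sigmaOf X B] t →
    P⟦s ∩ t | sigmaOf X C⟧ =ᵐ[P] P⟦s | sigmaOf X C⟧ * P⟦t | sigmaOf X C⟧

theorem sigmaOf_le {Ω : Type*} [mΩ : MeasurableSpace Ω] {E : V → Type*}
    [∀ v, MeasurableSpace (E v)] {X : ∀ v, Ω → E v} (hX : ∀ v, Measurable (X v)) (A : Set V) :
    sigmaOf X A ≤ mΩ :=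
  iSup₂_le fun v _ => (hX v).comap_le

/-- On a standard Borel space this is Mathlib's conditional independence. -/
theorem condIndepVars_iff_condIndep {Ω : Type*} [mΩ : MeasurableSpace Ω] [StandardBorelSpace Ω]
    (P : Measure Ω) [IsProbabilityMeasure P] {E : V → Type*} [∀ v, MeasurableSpace (E v)]
    (X : ∀ v, Ω → E v) (hX : ∀ v, Measurable (X v)) (A B C : Set V) :
    CondIndepVars P X A B C ↔
      CondIndep (sigmaOf X C) (sigmaOf X A) (sigmaOf X B) (sigmaOf_le hX C) P :=
  (condIndep_iff (sigmaOf X C) (sigmaOf X A) (sigmaOf X B) (sigmaOf_le hX C) (sigmaOf_le hX A)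
    (sigmaOf_le hX B) P).symm

/-- Every independence in the list `L` holds for the variables `X` under `P`. -/
def SatisfiesList {Ω : Type*} [MeasurableSpace Ω] (P : Measure Ω)
    {E : V → Type*} [∀ v, MeasurableSpace (E v)] (X : ∀ v, Ω → E v)
    (L : Set (CIStatement V)) : Prop :=
  ∀ s ∈ L, CondIndepVars P X s.left s.right s.given

/-- Semi-graphoids: sets of independence statements closed under the semi-graphoid axioms, for
pairwise disjoint sets of variables. -/
structure IsSemigraphoid (M : Set (CIStatement V)) : Prop where
  trivial : ∀ A C : Set V, Disjoint A C → ⟨A, ∅, C⟩ ∈ M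
  symmetry : ∀ A B C : Set V, Disjoint A B → Disjoint A C → Disjoint B C →
    ⟨A, B, C⟩ ∈ M → ⟨B, A, C⟩ ∈ M
  decomposition : ∀ A B D C : Set V, Disjoint A B → Disjoint A D → Disjoint A C →
    Disjoint B D → Disjoint B C → Disjoint D C → ⟨A, B ∪ D, C⟩ ∈ M → ⟨A, B, C⟩ ∈ M
  weak_union : ∀ A B D C : Set V, Disjoint A B → Disjoint A D → Disjoint A C →
    Disjoint B D → Disjoint B C → Disjoint D C → ⟨A, B ∪ D, C⟩ ∈ M → ⟨A, D, B ∪ C⟩ ∈ M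
  contraction : ∀ A B D C : Set V, Disjoint A B → Disjoint A D → Disjoint A C →
    Disjoint B D → Disjoint B C → Disjoint D C →
    ⟨A, B, C⟩ ∈ M → ⟨A, D, B ∪ C⟩ ∈ M → ⟨A, B ∪ D, C⟩ ∈ M

end Independence

namespace MixedGraph

variable {V : Type*} (G : MixedGraph V)

/-- The list of independences of the ordered local Markov property: one for every ancestral set
`A` and every childless vertex `v` of `A`. -/
def orderedLocal : Set (CIStatement V) :=
  {s | ∃ (A : Set V) (v : V), G.IsAncestral A ∧ v ∈ A ∧ G.ch {v} ∩ A = ∅ ∧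
    s = ⟨{v}, A \ (G.mb v A ∪ {v}), G.mb v A⟩}

variable [LinearOrder V]

/-- The order of the vertices is topological. -/
def IsTopological : Prop := ∀ v w, w ∈ G.an {v} → w ≤ v

/-- The heads whose maximal vertex is `i`. -/
def headsAt (i : V) : Set (Set V) := {H | G.IsHead H ∧ IsGreatest H i}

/-- The partial order on heads (in its reflexive form). -/
def HeadLE (H H' : Set V) : Prop :=
  (∃ i, IsGreatest H i ∧ IsGreatest H' i) ∧ G.an H ⊆ G.an H'

/-- The maximal head among the heads with maximal vertex `i`. -/
def IsMaximalHead (i : V) (H : Set V) : Prop :=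
  H ∈ G.headsAt i ∧ ∀ H' ∈ G.headsAt i, G.HeadLE H' H

/-- `H →^K H'` for two heads with maximal vertex `i`: marginalizing `K` in `G_{an(H)}` leads from
the head `H` to the head `H'`. -/
def Reaches (i : V) (H K H' : Set V) : Prop :=
  H ∈ G.headsAt i ∧ H' ∈ G.headsAt i ∧ K.Nonempty ∧ K ⊆ H \ {i} ∧
    (G.induced (G.an H \ K)).barren (G.disIn (G.an H \ K) {i}) = H'

/-- `H* →^k H'` is an edge of the refined power DAG for `i`: `H'` is a head other than the maximal
one, `k` is the minimum of `ceil(ham(H'))` and `H*` is the maximum of the parent heads `H` of `H'`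
with `H →^k H'`. -/
def RefinedEdge (i : V) (Hstar : Set V) (k : V) (H' : Set V) : Prop :=
  H' ∈ G.headsAt i ∧ ¬ G.IsMaximalHead i H' ∧
    IsLeast (G.ceil (G.ham H')) k ∧
    G.Reaches i Hstar {k} H' ∧ ∀ H, G.Reaches i H {k} H' → G.HeadLE H Hstar

/-- The independence associated with `H →^K H'`. -/
def edgeIndep (i : V) (H K H' : Set V) : CIStatement V :=
  ⟨{i}, (H ∪ G.tail H) \ (H' ∪ G.tail H' ∪ K), (H' ∪ G.tail H') \ {i}⟩

/-- The refined list of independences for `i`. -/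
def refinedListAt (i : V) : Set (CIStatement V) :=
  {⟨{i}, Iio i \ G.mb i (Iic i), G.mb i (Iic i)⟩} ∪
    {s | ∃ Hstar k H', G.RefinedEdge i Hstar k H' ∧ s = G.edgeIndep i Hstar {k} H'}

/-- The refined list of independences. -/
def refinedList : Set (CIStatement V) := ⋃ i, G.refinedListAt i

end MixedGraph

/-! ### Conditional independence and the semi-graphoid axioms -/

section Probability

variable {V Ω : Type*}

/-! Write N(v, A) for the district of `v` in `G_A` together with its parents (`closedBlanket`), and
L(v, A) for the statement `v ⊥ A \ N(v, A) | N(v, A) \ {v}` (`localIndep`). The ordered local Markov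
property consists of L(v, A) for all ancestral `A` and all `v` childless in `A`. Conditional
independence of random variables is a semi-graphoid (`isSemigraphoid_condIndepVars`), so everything
reduces to semi-graphoids.

It suffices to have L(i, A) when `i` is the greatest vertex of `A`
(`localIndep_of_forall_isGreatest`): induct on the size of `A`, deleting its greatest vertex `w`.
The step combines L(v, A \ {w}) with L(w, A), by contraction if `w` is outside the district of `v`,
and by an exchange argument (`localIndep_pair`) otherwise.

Now fix `i`. The blanket N(i, A) depends only on the head `H' = barren(dis_A(i))`. If `H'` is
maximal, L(i, A) is a decomposition of L(i, [i]). Otherwise the ancestral sets with greatest vertex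
`i` and head `H'` have a largest member `A'`, formed by the vertices up to `i` with no ancestor in
`ham(H')`; adjoining `k = min ham(H')` gives an ancestral set `B` whose head is `H*`
(`exists_refinedEdge`). By induction L(i, B) and L(k, B \ {i}) are available, and the exchange
argument drops `k` from the conditioning set: `i ⊥ B \ N(i, B) | N(i, B) \ {i, k}`. Contraction with
the independence of the edge then gives L(i, A) (`localIndep_of_refinedList`). Conversely, each
refined independence is a decomposition of some L(i, A) (`refinedList_subset_iff`).

The bound holds because a head indexes at most one statement: the first one of its `i` if it is
maximal, that of its unique incoming edge if not. -/

theorem indicator_inter_eq_mul (s t : Set Ω) :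
    ((s ∩ t).indicator fun _ => (1 : ℝ)) = s.indicator (fun _ => 1) * t.indicator fun _ => 1 := by
  funext x
  exact congrFun (Set.inter_indicator_one (M₀ := ℝ) (s := s) (t := t)) x

theorem isPiSystem_image2_inter (m₁ m₂ : MeasurableSpace Ω) :
    IsPiSystem (image2 (· ∩ ·) {s | MeasurableSet[m₁] s} {s | MeasurableSet[m₂] s}) := by
  rintro _ ⟨a, ha, b, hb, rfl⟩ _ ⟨c, hc, d, hd, rfl⟩ -
  exact ⟨a ∩ c, MeasurableSet.inter ha hc, b ∩ d, MeasurableSet.inter hb hd,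
    inter_inter_inter_comm a c b d⟩

theorem sup_eq_generateFrom_image2_inter (m₁ m₂ : MeasurableSpace Ω) :
    m₁ ⊔ m₂ = MeasurableSpace.generateFrom
      (image2 (· ∩ ·) {s | MeasurableSet[m₁] s} {s | MeasurableSet[m₂] s}) := by
  refine le_antisymm (sup_le ?_ ?_) (MeasurableSpace.generateFrom_le ?_)
  · exact fun s hs => MeasurableSpace.measurableSet_generateFrom
      ⟨s, hs, univ, MeasurableSet.univ, inter_univ s⟩
  · exact fun s hs => MeasurableSpace.measurableSet_generateFrom
      ⟨univ, MeasurableSet.univ, s, hs, univ_inter s⟩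
  · rintro _ ⟨a, ha, b, hb, rfl⟩
    exact @MeasurableSet.inter _ (m₁ ⊔ m₂) _ _ (le_sup_left (b := m₂) _ ha)
      (le_sup_right (a := m₁) _ hb)

variable {mΩ : MeasurableSpace Ω} {P : Measure Ω}

theorem integrable_indicator_one [IsProbabilityMeasure P] {s : Set Ω} (hs : MeasurableSet s) :
    Integrable (s.indicator fun _ => (1 : ℝ)) P :=
  (integrable_const 1).indicator hs

theorem integrable_indicator_one_mul {t : Set Ω} (ht : MeasurableSet t) {f : Ω → ℝ}
    (hf : Integrable f P) : Integrable (t.indicator (fun _ => (1 : ℝ)) * f) P := by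
  have : t.indicator (fun _ => (1 : ℝ)) * f = t.indicator f := by
    funext x
    by_cases hx : x ∈ t <;> simp [hx]
  rw [this]
  exact hf.indicator ht

/-- Equality of the set integrals of two functions propagates from `m₁` and `m₂` to `m₁ ⊔ m₂`. -/
theorem setIntegral_eq_of_sup {m₁ m₂ : MeasurableSpace Ω} (h₁ : m₁ ≤ mΩ) (h₂ : m₂ ≤ mΩ)
    {f g : Ω → ℝ} (hf : Integrable f P) (hg : Integrable g P)
    (h : ∀ b c, MeasurableSet[m₁] b → MeasurableSet[m₂] c →
      ∫ x in b ∩ c, f x ∂P = ∫ x in b ∩ c, g x ∂P)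
    (t : Set Ω) (ht : MeasurableSet[m₁ ⊔ m₂] t) : ∫ x in t, f x ∂P = ∫ x in t, g x ∂P := by
  have hle : m₁ ⊔ m₂ ≤ mΩ := sup_le h₁ h₂
  induction t, ht using MeasurableSpace.induction_on_inter
    (sup_eq_generateFrom_image2_inter m₁ m₂) (isPiSystem_image2_inter m₁ m₂) with
  | empty => simp
  | basic t ht =>
    obtain ⟨b, hb, c, hc, rfl⟩ := ht
    exact h b c hb hc
  | compl t htm ih =>
    -- Complements need the total integrals to agree, which is the hypothesis for the trivial
    -- rectangle.
    have huniv := h univ univ MeasurableSet.univ MeasurableSet.univ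
    simp only [inter_univ, setIntegral_univ] at huniv
    rw [setIntegral_compl (hle _ htm) hf, setIntegral_compl (hle _ htm) hg, ih, huniv]
  | iUnion s hd hm ih =>
    rw [integral_iUnion (fun i => hle _ (hm i)) hd hf.integrableOn,
      integral_iUnion (fun i => hle _ (hm i)) hd hg.integrableOn]
    simp only [ih]

/-- Conditional independence says that conditioning on more variables does not change the
conditional probabilities. -/
theorem condExp_inter_eq_mul_iff [IsProbabilityMeasure P] {m₁ m₂ m : MeasurableSpace Ω}
    (h₁ : m₁ ≤ mΩ) (h₂ : m₂ ≤ mΩ) (hm : m ≤ mΩ) :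
    (∀ s t : Set Ω, MeasurableSet[m₁] s → MeasurableSet[m₂] t →
        P⟦s ∩ t | m⟧ =ᵐ[P] P⟦s | m⟧ * P⟦t | m⟧) ↔
      ∀ s : Set Ω, MeasurableSet[m₁] s → P⟦s | m₂ ⊔ m⟧ =ᵐ[P] P⟦s | m⟧ := by
  have hle : m₂ ⊔ m ≤ mΩ := sup_le h₂ hm
  constructor
  · intro h s hs
    symm
    refine ae_eq_condExp_of_forall_setIntegral_eq hle (integrable_indicator_one (h₁ s hs))
      (fun _ _ _ => integrable_condExp.integrableOn) (fun t ht _ => ?_)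
      (stronglyMeasurable_condExp.mono (le_sup_right (a := m₂))).aestronglyMeasurable
    refine setIntegral_eq_of_sup h₂ hm integrable_condExp (integrable_indicator_one (h₁ s hs))
      (fun b c hb hc => ?_) t ht
    have hb' := h₂ b hb
    have hc' := hm c hc
    have hmul : ∀ f : Ω → ℝ, ∫ x in b ∩ c, f x ∂P =
        ∫ x in c, (b.indicator (fun _ => (1 : ℝ)) * f) x ∂P := by
      intro f
      have : b.indicator (fun _ => (1 : ℝ)) * f = b.indicator f := by
        funext x
        by_cases hx : x ∈ b <;> simp [hx]
      rw [this, setIntegral_indicator hb', inter_comm]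
    -- Since `c` is `m`-measurable, both integrands may be replaced by their conditional
    -- expectations given `m`; these agree by the assumed product formula.
    rw [hmul, hmul, ← setIntegral_condExp hm
        (integrable_indicator_one_mul hb' integrable_condExp) hc,
      ← setIntegral_condExp hm
        (integrable_indicator_one_mul hb' (integrable_indicator_one (h₁ s hs))) hc]
    refine setIntegral_congr_ae hc' ?_
    have e₁ := condExp_mul_of_stronglyMeasurable_right (m := m) (μ := P)
      (f := b.indicator fun _ => (1 : ℝ)) (g := P⟦s | m⟧) stronglyMeasurable_condExp
      (integrable_indicator_one_mul hb' integrable_condExp) (integrable_indicator_one hb')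
    have e₂ := h s b hs hb
    rw [inter_comm, indicator_inter_eq_mul] at e₂
    filter_upwards [e₁, e₂] with x hx₁ hx₂ _
    rw [hx₁, hx₂, Pi.mul_apply, Pi.mul_apply, mul_comm]
  · intro h s t hs ht
    have hs' := h₁ s hs
    have ht' := h₂ t ht
    have htm : MeasurableSet[m₂ ⊔ m] t := le_sup_left (b := m) _ ht
    rw [inter_comm, indicator_inter_eq_mul]
    have e₁ : P[t.indicator (fun _ => (1 : ℝ)) * s.indicator (fun _ => 1) | m₂ ⊔ m] =ᵐ[P]
        t.indicator (fun _ => (1 : ℝ)) * P⟦s | m₂ ⊔ m⟧ :=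
      condExp_mul_of_stronglyMeasurable_left
        ((@stronglyMeasurable_const _ _ (m₂ ⊔ m) _ (1 : ℝ)).indicator htm)
        (integrable_indicator_one_mul ht' (integrable_indicator_one hs'))
        (integrable_indicator_one hs')
    have e₂ : t.indicator (fun _ => (1 : ℝ)) * P⟦s | m₂ ⊔ m⟧ =ᵐ[P]
        t.indicator (fun _ => (1 : ℝ)) * P⟦s | m⟧ := (Filter.EventuallyEq.refl _ _).mul (h s hs)
    have e₃ : P[t.indicator (fun _ => (1 : ℝ)) * P⟦s | m⟧ | m] =ᵐ[P] P⟦t | m⟧ * P⟦s | m⟧ :=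
      condExp_mul_of_stronglyMeasurable_right stronglyMeasurable_condExp
        (integrable_indicator_one_mul ht' integrable_condExp) (integrable_indicator_one ht')
    -- Tower property: given `m₂ ⊔ m` the indicator of `t` factors out and the hypothesis applies;
    -- given `m` the factor `P⟦s | m⟧` comes out.
    calc P[t.indicator (fun _ => (1 : ℝ)) * s.indicator (fun _ => 1) | m]
        =ᵐ[P] P[P[t.indicator (fun _ => (1 : ℝ)) * s.indicator (fun _ => 1) | m₂ ⊔ m] | m] :=
          (condExp_condExp_of_le le_sup_right hle).symm
      _ =ᵐ[P] P[t.indicator (fun _ => (1 : ℝ)) * P⟦s | m⟧ | m] :=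
          condExp_congr_ae (e₁.trans e₂)
      _ =ᵐ[P] P⟦t | m⟧ * P⟦s | m⟧ := e₃
      _ = P⟦s | m⟧ * P⟦t | m⟧ := mul_comm _ _

variable {E : V → Type*} [∀ v, MeasurableSpace (E v)] {X : ∀ v, Ω → E v}

theorem sigmaOf_union (X : ∀ v, Ω → E v) (A B : Set V) :
    sigmaOf X (A ∪ B) = sigmaOf X A ⊔ sigmaOf X B :=
  iSup_union

theorem condIndepVars_iff_condExp_eq [IsProbabilityMeasure P] (hX : ∀ v, Measurable (X v))
    (A B C : Set V) :
    CondIndepVars P X A B C ↔ ∀ s : Set Ω, MeasurableSet[sigmaOf X A] s →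
      P⟦s | sigmaOf X (B ∪ C)⟧ =ᵐ[P] P⟦s | sigmaOf X C⟧ := by
  rw [sigmaOf_union]
  exact condExp_inter_eq_mul_iff (sigmaOf_le hX A) (sigmaOf_le hX B) (sigmaOf_le hX C)

theorem CondIndepVars.symm {A B C : Set V} (h : CondIndepVars P X A B C) :
    CondIndepVars P X B A C := by
  intro s t hs ht
  rw [inter_comm, mul_comm]
  exact h t s ht hs

theorem CondIndepVars.mono_right {A B D C : Set V} (h : CondIndepVars P X A B C) (hD : D ⊆ B) :
    CondIndepVars P X A D C :=
  fun s t hs ht => h s t hs ((biSup_mono (fun _ hv => hD hv) : sigmaOf X D ≤ sigmaOf X B) t ht)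

/-- The conditional independences satisfied by random variables form a semi-graphoid. -/
theorem isSemigraphoid_condIndepVars [IsProbabilityMeasure P] (hX : ∀ v, Measurable (X v)) :
    IsSemigraphoid {s : CIStatement V | CondIndepVars P X s.left s.right s.given} where
  trivial A C _ := by
    refine (condIndepVars_iff_condExp_eq hX A ∅ C).2 fun s _ => ?_
    rw [empty_union]
  symmetry A B C _ _ _ h := CondIndepVars.symm h
  decomposition A B D C _ _ _ _ _ _ h := CondIndepVars.mono_right h subset_union_left
  weak_union A B D C _ _ _ _ _ _ h := by
    refine (condIndepVars_iff_condExp_eq hX A D (B ∪ C)).2 fun s hs => ?_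
    have h₁ := (condIndepVars_iff_condExp_eq hX _ _ _).1 h s hs
    have h₂ := (condIndepVars_iff_condExp_eq hX _ _ _).1
      (CondIndepVars.mono_right h subset_union_left) s hs
    rw [← union_assoc, union_comm D B]
    exact h₁.trans h₂.symm
  contraction A B D C _ _ _ _ _ _ h h' := by
    refine (condIndepVars_iff_condExp_eq hX A (B ∪ D) C).2 fun s hs => ?_
    have h₁ := (condIndepVars_iff_condExp_eq hX _ _ _).1 h s hs
    have h₂ := (condIndepVars_iff_condExp_eq hX _ _ _).1 h' s hs
    rw [union_comm B D, union_assoc]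
    exact h₂.trans h₁

end Probability

/-! ### Consequences of the semi-graphoid axioms -/

namespace IsSemigraphoid

variable {V : Type*} {M : Set (CIStatement V)}

theorem mono_right (hM : IsSemigraphoid M) {A B B' C : Set V} (hAB : Disjoint A B)
    (hAC : Disjoint A C) (hBC : Disjoint B C) (hB : B' ⊆ B) (h : ⟨A, B, C⟩ ∈ M) :
    ⟨A, B', C⟩ ∈ M := by
  have hdiff : B \ B' ⊆ B := sdiff_subset
  refine hM.decomposition A B' (B \ B') C (hAB.mono_right hB) (hAB.mono_right hdiff) hAC
    disjoint_sdiff_right (hBC.mono_left hB) (hBC.mono_left hdiff) ?_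
  rwa [union_sdiff_cancel hB]

/-- Weak union followed by decomposition: part of `B` moves into the conditioning set and the rest
is cut down to `D`. -/
theorem enlarge_given (hM : IsSemigraphoid M) {A B C D C' : Set V} (hAB : Disjoint A B)
    (hAC : Disjoint A C) (hBC : Disjoint B C) (hC : C ⊆ C') (hC' : C' ⊆ C ∪ B) (hD : D ⊆ B)
    (hDC : Disjoint D C') (h : ⟨A, B, C⟩ ∈ M) : ⟨A, D, C'⟩ ∈ M := by
  have hsub : C' \ C ⊆ B := fun x hx => (hC' hx.1).resolve_left hx.2
  have h' := hM.mono_right hAB hAC hBC (union_subset hsub hD) h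
  have h'' := hM.weak_union A (C' \ C) D C (hAB.mono_right hsub) (hAB.mono_right hD) hAC
    (hDC.symm.mono_left sdiff_subset) (hBC.mono_left hsub) (hBC.mono_left hD) h'
  rwa [sdiff_union_of_subset hC] at h''

/-- From `w ⊥ R | C` and `v ⊥ R | C ∪ {w}`, deduce `v ⊥ R | C` and `w ⊥ R | C ∪ {v}`. -/
theorem exchange (hM : IsSemigraphoid M) {v w : V} {R C : Set V} (hvw : v ≠ w) (hvR : v ∉ R)
    (hwR : w ∉ R) (hvC : v ∉ C) (hwC : w ∉ C) (hRC : Disjoint R C)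
    (hw : ⟨{w}, R, C⟩ ∈ M) (hv : ⟨{v}, R, {w} ∪ C⟩ ∈ M) :
    ⟨{v}, R, C⟩ ∈ M ∧ ⟨{w}, R, {v} ∪ C⟩ ∈ M := by
  have dvR : Disjoint {v} R := disjoint_singleton_left.2 hvR
  have dwR : Disjoint {w} R := disjoint_singleton_left.2 hwR
  have dvC : Disjoint {v} C := disjoint_singleton_left.2 hvC
  have dwC : Disjoint {w} C := disjoint_singleton_left.2 hwC
  have dvw : Disjoint ({v} : Set V) {w} := disjoint_singleton.2 hvw
  have h₁ := hM.symmetry _ _ _ dwR dwC hRC hw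
  have h₂ := hM.symmetry _ _ _ dvR (disjoint_union_right.2 ⟨dvw, dvC⟩)
    (disjoint_union_right.2 ⟨dwR.symm, hRC⟩) hv
  have h₃ := hM.contraction R {w} {v} C dwR.symm dvR.symm hRC dvw.symm dwC dvC h₁ h₂
  refine ⟨hM.symmetry _ _ _ dvR.symm hRC dvC ?_, hM.symmetry _ _ _ dwR.symm
    (disjoint_union_right.2 ⟨dvR.symm, hRC⟩) (disjoint_union_right.2 ⟨dvw.symm, dwC⟩) ?_⟩
  · exact hM.decomposition R {v} {w} C dvR.symm dwR.symm hRC dvw dvC dwC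
      (by rwa [union_comm])
  · exact hM.weak_union R {v} {w} C dvR.symm dwR.symm hRC dvw dvC dwC (by rwa [union_comm])

end IsSemigraphoid

namespace MixedGraph

variable {V : Type*} {G : MixedGraph V}

/-! ### Ancestral sets -/

theorem mem_an_singleton {v w : V} : w ∈ G.an {v} ↔ Relation.ReflTransGen G.dir w v := by
  simp [an]

theorem isAncestral_iff {A : Set V} :
    G.IsAncestral A ↔ ∀ x y, G.dir x y → y ∈ A → x ∈ A := by
  constructor
  · intro h x y hxy hy
    rw [← h]
    exact ⟨y, hy, .single hxy⟩
  · intro h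
    refine Subset.antisymm ?_ fun x hx => ⟨x, hx, .refl⟩
    rintro x ⟨y, hy, hxy⟩
    induction hxy using Relation.ReflTransGen.head_induction_on with
    | refl => exact hy
    | head hab _ ih => exact h _ _ hab ih

theorem IsAncestral.mem_of_reflTransGen {A : Set V} (hA : G.IsAncestral A) {x y : V}
    (h : Relation.ReflTransGen G.dir x y) (hy : y ∈ A) : x ∈ A := by
  rw [← hA]
  exact ⟨y, hy, h⟩

theorem subset_an (W : Set V) : W ⊆ G.an W := fun x hx => ⟨x, hx, .refl⟩

theorem isAncestral_an (W : Set V) : G.IsAncestral (G.an W) :=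
  isAncestral_iff.2 fun _ _ hxy ⟨z, hz, hyz⟩ => ⟨z, hz, .head hxy hyz⟩

theorem IsAncestral.an_subset {A W : Set V} (hA : G.IsAncestral A) (hW : W ⊆ A) :
    G.an W ⊆ A := fun _ ⟨_, hy, hxy⟩ => hA.mem_of_reflTransGen hxy (hW hy)

theorem an_mono {W W' : Set V} (h : W ⊆ W') : G.an W ⊆ G.an W' :=
  (isAncestral_an W').an_subset (h.trans (subset_an W'))

theorem IsAncestral.diff_singleton {A : Set V} (hA : G.IsAncestral A) {k : V}
    (hk : ∀ y ∈ A, ¬ G.dir k y) : G.IsAncestral (A \ {k}) := by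
  refine isAncestral_iff.2 fun x y hxy hy => ⟨isAncestral_iff.1 hA x y hxy hy.1, ?_⟩
  rintro rfl
  exact hk y hy.1 hxy

/-! ### Districts -/

theorem mem_disIn_self (A : Set V) (v : V) : v ∈ G.disIn A {v} := ⟨v, rfl, .refl⟩

theorem disIn_subset {A : Set V} {v : V} (hv : v ∈ A) : G.disIn A {v} ⊆ A := by
  rintro x ⟨_, rfl, h⟩
  induction h using Relation.ReflTransGen.head_induction_on with
  | refl => exact hv
  | head hab _ _ => exact hab.1

theorem mem_disIn_of_bi {A : Set V} {v x y : V} (hv : v ∈ A) (hx : x ∈ G.disIn A {v})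
    (hy : y ∈ A) (hyx : G.bi y x) : y ∈ G.disIn A {v} := by
  have hxA := disIn_subset hv hx
  obtain ⟨_, rfl, h⟩ := hx
  exact ⟨_, rfl, .head ⟨hy, hxA, hyx⟩ h⟩

theorem disIn_subset_of_closed {A S : Set V} {v : V} (hv : v ∈ S)
    (hS : ∀ x ∈ S, ∀ y ∈ A, G.bi y x → y ∈ S) : G.disIn A {v} ⊆ S := by
  rintro x ⟨_, rfl, h⟩
  induction h using Relation.ReflTransGen.head_induction_on with
  | refl => exact hv
  | head hab _ ih => exact hS _ ih _ hab.1 hab.2.2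

theorem disIn_mono {A B : Set V} (h : A ⊆ B) (v : V) : G.disIn A {v} ⊆ G.disIn B {v} := by
  rintro x ⟨_, rfl, hx⟩
  exact ⟨_, rfl, Relation.ReflTransGen.mono (fun a b hab => ⟨h hab.1, h hab.2.1, hab.2.2⟩) _ _ hx⟩

/-- The set `C` need not lie in `A`: it is enough that no bidirected edge of `G_C` leaves the
district, while every bidirected path of `G_A` from `v` stays in the district and hence in `C`. -/
theorem disIn_eq_of_closed {A C : Set V} {v : V} (hv : v ∈ A) (hC : G.disIn A {v} ⊆ C)
    (h : ∀ x ∈ G.disIn A {v}, ∀ y ∈ C, G.bi y x → y ∈ G.disIn A {v}) :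
    G.disIn C {v} = G.disIn A {v} := by
  refine Subset.antisymm (disIn_subset_of_closed (mem_disIn_self A v) h) ?_
  suffices G.disIn A {v} ⊆ {x | x ∈ G.disIn A {v} ∧ x ∈ G.disIn C {v}} from
    fun x hx => (this hx).2
  refine disIn_subset_of_closed ⟨mem_disIn_self A v, mem_disIn_self C v⟩ ?_
  rintro x ⟨hxA, hxC⟩ y hy hyx
  have hyA := mem_disIn_of_bi hv hxA hy hyx
  exact ⟨hyA, mem_disIn_of_bi (hC (mem_disIn_self A v)) hxC (hC hyA) hyx⟩

theorem disIn_eq_of_subset {A C : Set V} {v : V} (hv : v ∈ A) (hC : G.disIn A {v} ⊆ C)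
    (hCA : C ⊆ A) : G.disIn C {v} = G.disIn A {v} :=
  disIn_eq_of_closed hv hC fun _ hx _ hy hyx => mem_disIn_of_bi hv hx (hCA hy) hyx

theorem mem_disIn_symm {A : Set V} {v w : V} (h : w ∈ G.disIn A {v}) : v ∈ G.disIn A {w} := by
  obtain ⟨_, rfl, h⟩ := h
  have : Std.Symm (G.induced A).bi := ⟨fun a b => (G.induced A).bi_symm a b⟩
  exact ⟨_, rfl, (Relation.ReflTransGen.stdSymm (r := (G.induced A).bi)).symm _ _ h⟩

theorem disIn_eq_of_mem {A : Set V} {v w : V} (h : w ∈ G.disIn A {v}) :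
    G.disIn A {w} = G.disIn A {v} := by
  have key : ∀ a b, b ∈ G.disIn A {a} → G.disIn A {b} ⊆ G.disIn A {a} := by
    rintro a b ⟨_, rfl, hb⟩ x ⟨_, rfl, hx⟩
    exact ⟨_, rfl, hx.trans hb⟩
  exact Subset.antisymm (key _ _ h) (key _ _ (mem_disIn_symm h))

theorem disIn_eq_of_subset_disIn {A H : Set V} {v w : V} (hw : w ∈ H)
    (h : H ⊆ G.disIn A {v}) : G.disIn A H = G.disIn A {w} := by
  refine Subset.antisymm ?_ ?_
  · rintro x ⟨y, hy, hxy⟩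
    rw [disIn_eq_of_mem (h hw), ← disIn_eq_of_mem (h hy)]
    exact ⟨y, rfl, hxy⟩
  · rintro x ⟨_, rfl, hx⟩
    exact ⟨_, hw, hx⟩

/-! ### Markov blankets -/

/-- The Markov blanket of `v` in `A` together with `v` itself. -/
def closedBlanket (G : MixedGraph V) (v : V) (A : Set V) : Set V :=
  G.disIn A {v} ∪ G.pa (G.disIn A {v})

theorem mem_closedBlanket_self (v : V) (A : Set V) : v ∈ G.closedBlanket v A :=
  .inl (mem_disIn_self A v)

theorem pa_mono {W W' : Set V} (h : W ⊆ W') : G.pa W ⊆ G.pa W' :=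
  fun _ ⟨y, hy, hxy⟩ => ⟨y, h hy, hxy⟩

theorem closedBlanket_subset {A : Set V} (hA : G.IsAncestral A) {v : V} (hv : v ∈ A) :
    G.closedBlanket v A ⊆ A :=
  union_subset (disIn_subset hv) fun _ ⟨_, hy, hxy⟩ =>
    isAncestral_iff.1 hA _ _ hxy (disIn_subset hv hy)

theorem closedBlanket_mono {A B : Set V} (h : A ⊆ B) (v : V) :
    G.closedBlanket v A ⊆ G.closedBlanket v B :=
  union_subset_union (disIn_mono h v) (pa_mono (disIn_mono h v))

theorem mb_eq {A : Set V} (hA : G.IsAncestral A) {v : V} (hv : v ∈ A) :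
    G.mb v A = G.closedBlanket v A \ {v} := by
  have : (G.induced A).pa (G.disIn A {v}) = G.pa (G.disIn A {v}) := by
    ext x
    constructor
    · rintro ⟨y, hy, hxy⟩
      exact ⟨y, hy, hxy.2.2⟩
    · rintro ⟨y, hy, hxy⟩
      have hyA := disIn_subset hv hy
      exact ⟨y, hy, isAncestral_iff.1 hA _ _ hxy hyA, hyA, hxy⟩
  rw [mb, this, union_comm, closedBlanket]

/-- The independence of `v` from the rest of `A` given its Markov blanket. -/
def localIndep (G : MixedGraph V) (v : V) (A : Set V) : CIStatement V :=
  ⟨{v}, A \ G.closedBlanket v A, G.closedBlanket v A \ {v}⟩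

theorem localIndep_eq {A : Set V} (hA : G.IsAncestral A) {v : V} (hv : v ∈ A) :
    (⟨{v}, A \ (G.mb v A ∪ {v}), G.mb v A⟩ : CIStatement V) = G.localIndep v A := by
  have := mem_closedBlanket_self (G := G) v A
  rw [mb_eq hA hv, localIndep, sdiff_union_of_subset (singleton_subset_iff.2 this)]

theorem orderedLocal_subset_iff {M : Set (CIStatement V)} :
    G.orderedLocal ⊆ M ↔ ∀ A v, G.IsAncestral A → v ∈ A → (∀ y ∈ A, ¬ G.dir v y) →
      G.localIndep v A ∈ M := by
  constructor
  · intro h A v hA hv hch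
    refine h ⟨A, v, hA, hv, ?_, (localIndep_eq hA hv).symm⟩
    ext y
    simp only [ch, mem_inter_iff, mem_ofPred_eq, mem_singleton_iff, exists_eq_left,
      mem_empty_iff_false, iff_false, not_and]
    exact fun hvy hy => hch y hy hvy
  · rintro h _ ⟨A, v, hA, hv, hch, rfl⟩
    rw [localIndep_eq hA hv]
    refine h A v hA hv fun y hy hvy => ?_
    have : y ∈ G.ch {v} ∩ A := ⟨⟨v, rfl, hvy⟩, hy⟩
    rw [hch] at this
    exact this

/-- If `v` is childless in `A` and lies outside the district of `w`, it is not in the closed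
blanket of `w`. -/
theorem notMem_closedBlanket {A : Set V} {v w : V} (hw : w ∈ A) (hv : ∀ y ∈ A, ¬ G.dir v y)
    (h : v ∉ G.disIn A {w}) : v ∉ G.closedBlanket w A := by
  rintro (h' | ⟨y, hy, hvy⟩)
  · exact h h'
  · exact hv y (disIn_subset hw hy) hvy

/-! ### Local independences inside a semi-graphoid -/

variable {M : Set (CIStatement V)}

/-- The step removing a childless vertex `w` when it is not in the district of `v`. -/
theorem localIndep_of_notMem_disIn (hM : IsSemigraphoid M) {A : Set V} {v w : V}
    (hA : G.IsAncestral A) (hv : v ∈ A) (hw : w ∈ A) (hvw : v ≠ w) (hvc : ∀ y ∈ A, ¬ G.dir v y)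
    (hwc : ∀ y ∈ A, ¬ G.dir w y) (hd : w ∉ G.disIn A {v}) (h : G.localIndep v (A \ {w}) ∈ M)
    (hwM : G.localIndep w A ∈ M) : G.localIndep v A ∈ M := by
  have hdis : G.disIn (A \ {w}) {v} = G.disIn A {v} :=
    disIn_eq_of_subset hv
      (fun x hx => ⟨disIn_subset hv hx, fun hxw => hd (hxw ▸ hx)⟩) sdiff_subset
  have hw' := notMem_closedBlanket hv hwc hd
  have hv' := notMem_closedBlanket hw hvc fun hv' => hd (mem_disIn_symm hv')
  have hNA := closedBlanket_subset hA hv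
  have hNwA := closedBlanket_subset hA hw
  have hvN := mem_closedBlanket_self (G := G) v A
  have hwN := mem_closedBlanket_self (G := G) w A
  unfold localIndep at h hwM ⊢
  have hN : G.closedBlanket v (A \ {w}) = G.closedBlanket v A := by
    rw [closedBlanket, hdis, closedBlanket]
  rw [hN] at h
  set N := G.closedBlanket v A
  set N' := G.closedBlanket w A
  -- Here `v ∉ N'`, so weak union in the statement for `w` puts all other vertices of `A` into the
  -- conditioning set.
  have h₁ : ⟨{w}, {v}, A \ {v, w}⟩ ∈ M := by
    refine hM.enlarge_given ?_ ?_ ?_ ?_ ?_ ?_ ?_ hwM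
    all_goals first | rw [disjoint_left] | skip
    all_goals intro x
    all_goals simp only [mem_sdiff, mem_singleton_iff, mem_union, mem_insert_iff]
    all_goals grind
  have h₂ := hM.symmetry _ _ _ (by simpa using hvw.symm) (by simp) (by simp) h₁
  have h₃ := hM.contraction {v} ((A \ {w}) \ N) {w} (N \ {v})
    (by simp [hvN]) (by simpa using hvw) (by simp)
    (by simp) (disjoint_left.2 fun x hx hx' => hx.2 hx'.1) (by simp [hw']) h
    (by
      convert h₂ using 2
      ext x
      simp only [mem_sdiff, mem_singleton_iff, mem_union, mem_insert_iff]
      grind)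
  convert h₃ using 2
  ext x
  simp only [mem_sdiff, mem_singleton_iff, mem_union]
  grind

/-- For `v` and a childless `w` in one district of `A`, the local independence of `v` in `A \ {w}`
and that of `w` in `A` separate each of them from the rest of `A`. -/
theorem localIndep_pair (hM : IsSemigraphoid M) {A : Set V} {v w : V}
    (hA : G.IsAncestral A) (hv : v ∈ A) (hvw : v ≠ w)
    (hwc : ∀ y ∈ A, ¬ G.dir w y) (hd : w ∈ G.disIn A {v}) (h : G.localIndep v (A \ {w}) ∈ M)
    (hwM : G.localIndep w A ∈ M) :
    ⟨{w}, A \ G.closedBlanket w A, G.closedBlanket w A \ {v, w}⟩ ∈ M ∧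
      G.localIndep v A ∈ M := by
  have hN : G.closedBlanket v A = G.closedBlanket w A := by
    rw [closedBlanket, ← disIn_eq_of_mem hd, closedBlanket]
  have hA' := hA.diff_singleton hwc
  have hN'A := closedBlanket_subset hA' (v := v) ⟨hv, hvw⟩
  have hN'N := closedBlanket_mono (G := G) (A := A \ {w}) sdiff_subset v
  have hvN' := mem_closedBlanket_self (G := G) v (A \ {w})
  have hvN := mem_closedBlanket_self (G := G) v A
  have hwN := mem_closedBlanket_self (G := G) w A
  have hNA := closedBlanket_subset hA hv
  unfold localIndep at h hwM ⊢
  rw [hN] at hvN hN'N hNA ⊢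
  set N := G.closedBlanket w A
  set N' := G.closedBlanket v (A \ {w})
  -- As `N' ⊆ N`, the vertices of `N \ N'` other than `w` move into the conditioning set.
  have h₁ : ⟨{v}, A \ N, N \ {v, w}⟩ ∈ M := by
    refine hM.enlarge_given ?_ ?_ ?_ ?_ ?_ ?_ ?_ h
    all_goals first | rw [disjoint_left] | skip
    all_goals intro x
    all_goals simp only [mem_sdiff, mem_singleton_iff, mem_union, mem_insert_iff]
    all_goals grind
  have e : ∀ a b, a ≠ b → a ∈ N → {a} ∪ N \ {a, b} = N \ {b} := by
    intro a b hab ha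
    ext x
    simp only [mem_sdiff, mem_singleton_iff, mem_union, mem_insert_iff]
    grind
  have key := hM.exchange (v := w) (w := v) (R := A \ N) (C := N \ {v, w}) hvw.symm
    (fun hx => hx.2 hwN) (fun hx => hx.2 hvN) (by simp) (by simp)
    (disjoint_left.2 fun x hx hx' => hx.2 hx'.1) h₁ (by rwa [e v w hvw hvN])
  refine ⟨key.1, ?_⟩
  have := key.2
  rwa [pair_comm, e w v hvw.symm hwN] at this

/-- The local independences for the maximal vertices of ancestral sets imply those for all
childless vertices. -/
theorem localIndep_of_forall_isGreatest [Finite V] [LinearOrder V] (htop : G.IsTopological)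
    (hM : IsSemigraphoid M) (n : ℕ) :
    ∀ A : Set V, A.ncard = n → G.IsAncestral A →
      (∀ B ⊆ A, G.IsAncestral B → ∀ i, IsGreatest B i → G.localIndep i B ∈ M) →
      ∀ v ∈ A, (∀ y ∈ A, ¬ G.dir v y) → G.localIndep v A ∈ M := by
  induction n using Nat.strong_induction_on with
  | _ n ih =>
    intro A hn hA hmax v hv hvc
    obtain ⟨w, hw, hwmax⟩ := A.toFinite.exists_maximalFor id A ⟨v, hv⟩
    have hwg : IsGreatest A w := ⟨hw, fun x hx => by
      by_contra hlt
      exact hlt (hwmax hx (le_of_not_ge hlt))⟩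
    have hwM := hmax A le_rfl hA w hwg
    by_cases hvw : v = w
    · exact hvw ▸ hwM
    have hwc : ∀ y ∈ A, ¬ G.dir w y := fun y hy hwy =>
      G.dir_irrefl w <| by
        have := le_antisymm (hwg.2 hy) (htop y w (mem_an_singleton.2 (.single hwy)))
        rwa [this] at hwy
    have hlt : (A \ {w}).ncard < n := hn ▸ ncard_sdiff_singleton_lt_of_mem hw
    have h := ih _ hlt (A \ {w}) rfl (hA.diff_singleton hwc)
      (fun B hB => hmax B (hB.trans sdiff_subset)) v ⟨hv, hvw⟩ fun y hy => hvc y hy.1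
    by_cases hd : w ∈ G.disIn A {v}
    · exact (localIndep_pair hM hA hv hvw hwc hd h hwM).2
    · exact localIndep_of_notMem_disIn hM hA hv hw hvw hvc hwc hd h hwM


/-! ### Heads -/

/-- A directed path ending in an ancestral set never leaves it, so descendants within `W` are the
same in both graphs. -/
theorem IsAncestral.barren_induced {A W : Set V} (hA : G.IsAncestral A) (hW : W ⊆ A) :
    (G.induced A).barren W = G.barren W := by
  have key : ∀ w, (G.induced A).de {w} ∩ W = G.de {w} ∩ W := by
    intro w
    ext x
    refine and_congr_left fun hx => ?_
    constructor
    · rintro ⟨_, rfl, h⟩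
      exact ⟨_, rfl, Relation.ReflTransGen.mono (fun a b hab => hab.2.2) _ _ h⟩
    · rintro ⟨_, rfl, h⟩
      refine ⟨_, rfl, ?_⟩
      have hxA := hW hx
      clear hx
      induction h with
      | refl => exact .refl
      | tail _ hbc ih =>
        have hb := isAncestral_iff.1 hA _ _ hbc hxA
        exact (ih hb).tail ⟨hb, hxA, hbc⟩
  simp only [barren, key]

theorem mem_barren_iff {W : Set V} {w : V} :
    w ∈ G.barren W ↔ w ∈ W ∧ ∀ x ∈ W, Relation.ReflTransGen G.dir w x → x = w := by
  refine and_congr_right fun hw => ?_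
  rw [Subset.antisymm_iff]
  constructor
  · exact fun h x hx hwx => h.1 ⟨⟨w, rfl, hwx⟩, hx⟩
  · refine fun h => ⟨?_, ?_⟩
    · rintro x ⟨⟨_, rfl, hwx⟩, hx⟩
      exact h x hx hwx
    · rintro _ rfl
      exact ⟨⟨_, rfl, .refl⟩, hw⟩

theorem barren_subset (W : Set V) : G.barren W ⊆ W := fun _ h => h.1

theorem barren_barren (W : Set V) : G.barren (G.barren W) = G.barren W :=
  Subset.antisymm (barren_subset _) fun _ hx => mem_barren_iff.2
    ⟨hx, fun y hy => (mem_barren_iff.1 hx).2 y hy.1⟩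

theorem an_barren_disIn_subset {A : Set V} {i : V} (hA : G.IsAncestral A)
    (hi : i ∈ A) :
    G.an (G.barren (G.disIn A {i})) ⊆ A :=
  hA.an_subset ((barren_subset _).trans (disIn_subset hi))

variable [LinearOrder V]

theorem IsTopological.le (htop : G.IsTopological) {x y : V}
    (h : Relation.ReflTransGen G.dir x y) : x ≤ y := htop y x (mem_an_singleton.2 h)

theorem IsTopological.not_dir (htop : G.IsTopological) {x y : V} (h : y ≤ x) :
    ¬ G.dir x y := fun hxy => by
  have := le_antisymm h (htop.le (.single hxy))
  subst this
  exact G.dir_irrefl _ hxy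

theorem IsTopological.isAncestral_Iic (htop : G.IsTopological) (i : V) :
    G.IsAncestral (Iic i) :=
  isAncestral_iff.2 fun _ _ hxy hy => (htop.le (.single hxy)).trans hy

theorem an_barren [Finite V] (htop : G.IsTopological) (W : Set V) :
    G.an (G.barren W) = G.an W := by
  refine Subset.antisymm (an_mono (barren_subset W)) ((isAncestral_an _).an_subset fun x hx => ?_)
  obtain ⟨y, ⟨hy, hxy⟩, hmax⟩ := exists_max_image {y | y ∈ W ∧ Relation.ReflTransGen G.dir x y}
    id (toFinite _) ⟨x, hx, .refl⟩
  refine ⟨y, mem_barren_iff.2 ⟨hy, fun z hz hyz => ?_⟩, hxy⟩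
  exact le_antisymm (hmax z ⟨hz, hxy.trans hyz⟩) (htop.le hyz)

/-- A barren set consists of the maximal elements, for the ancestor order, of the set of its
ancestors, and is therefore recovered from it. -/
theorem eq_of_an_eq (htop : G.IsTopological) {H H' : Set V} (hH : G.barren H = H)
    (hH' : G.barren H' = H') (h : G.an H = G.an H') : H = H' := by
  have key : ∀ H H' : Set V, G.barren H = H → G.an H = G.an H' → H ⊆ H' := by
    intro H H' hH h x hx
    obtain ⟨y, hy, hxy⟩ : x ∈ G.an H' := h ▸ subset_an H hx
    obtain ⟨z, hz, hyz⟩ : y ∈ G.an H := h ▸ subset_an H' hy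
    have hzx := (mem_barren_iff.1 (hH.symm ▸ hx : x ∈ G.barren H)).2 z hz (hxy.trans hyz)
    subst hzx
    rwa [le_antisymm (htop.le hxy) (htop.le hyz)]
  exact Subset.antisymm (key _ _ hH h) (key _ _ hH' h.symm)

/-! ### Heads with a given largest vertex -/

section HeadsAt

variable {i : V} {H : Set V}

theorem headsAt_an_subset (htop : G.IsTopological) (hH : H ∈ G.headsAt i) :
    G.an H ⊆ Iic i := (htop.isAncestral_Iic i).an_subset hH.2.2

theorem headsAt_mem_an (hH : H ∈ G.headsAt i) : i ∈ G.an H := subset_an H hH.2.1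

theorem headsAt_disIn (hH : H ∈ G.headsAt i) :
    G.disIn (G.an H) H = G.disIn (G.an H) {i} := by
  obtain ⟨⟨_, v, _, hv⟩, hi⟩ := hH
  exact disIn_eq_of_subset_disIn hi.1 hv

theorem headsAt_subset_disIn (hH : H ∈ G.headsAt i) : H ⊆ G.disIn (G.an H) {i} := by
  rw [← headsAt_disIn hH]
  exact fun x hx => ⟨x, hx, .refl⟩

theorem headsAt_union_tail (hH : H ∈ G.headsAt i) :
    H ∪ G.tail H = G.closedBlanket i (G.an H) := by
  rw [tail, headsAt_disIn hH, closedBlanket, ← union_assoc,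
    union_sdiff_cancel (headsAt_subset_disIn hH)]

theorem isMaximalHead_of_disIn_eq (htop : G.IsTopological) (hH : H ∈ G.headsAt i)
    (h : G.disIn (Iic i) {i} = G.disIn (G.an H) {i}) : G.IsMaximalHead i H := by
  refine ⟨hH, fun H' hH' => ⟨⟨i, hH'.2, hH.2⟩, (isAncestral_an H).an_subset ?_⟩⟩
  calc H' ⊆ G.disIn (G.an H') {i} := headsAt_subset_disIn hH'
    _ ⊆ G.disIn (Iic i) {i} := disIn_mono (headsAt_an_subset htop hH') i
    _ = G.disIn (G.an H) {i} := h
    _ ⊆ G.an H := disIn_subset (headsAt_mem_an hH)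

/-- In a topological order the least element of `W` has no other ancestor in `W`; so the minimum of
`ceil(ham(H'))` is simply that of `ham(H')`. -/
theorem isLeast_ceil (htop : G.IsTopological) {W : Set V} {k : V} (hk : IsLeast W k) :
    IsLeast (G.ceil W) k := by
  refine ⟨⟨hk.1, Subset.antisymm ?_ ?_⟩, fun x hx => hk.2 hx.1⟩
  · rintro x ⟨hx, hxk⟩
    exact le_antisymm (htop _ _ hxk) (hk.2 hx)
  · rintro _ rfl
    exact ⟨hk.1, mem_an_singleton.2 .refl⟩

theorem refinedEdge_unique (htop : G.IsTopological) {H₁ H₂ H' : Set V} {k₁ k₂ : V}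
    (h₁ : G.RefinedEdge i H₁ k₁ H') (h₂ : G.RefinedEdge i H₂ k₂ H') : H₁ = H₂ ∧ k₁ = k₂ := by
  obtain ⟨-, -, hk₁, hr₁, hm₁⟩ := h₁
  obtain ⟨-, -, hk₂, hr₂, hm₂⟩ := h₂
  obtain rfl := hk₁.unique hk₂
  exact ⟨eq_of_an_eq htop hr₁.1.1.1 hr₂.1.1.1
    (Subset.antisymm (hm₂ _ hr₁).2 (hm₁ _ hr₂).2), rfl⟩

variable [Finite V] {A : Set V}

/-- The ancestors of the barren part contain the whole district and stay inside `A`, so passing from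
`A` to its head loses neither the district nor the blanket of `i`. -/
theorem disIn_an_barren (htop : G.IsTopological) (hA : G.IsAncestral A) (hi : i ∈ A) :
    G.disIn (G.an (G.barren (G.disIn A {i}))) {i} = G.disIn A {i} :=
  disIn_eq_of_subset hi (by rw [an_barren htop]; exact subset_an _)
    (an_barren_disIn_subset hA hi)

theorem closedBlanket_an_barren (htop : G.IsTopological) (hA : G.IsAncestral A) (hi : i ∈ A) :
    G.closedBlanket i (G.an (G.barren (G.disIn A {i}))) = G.closedBlanket i A := by
  rw [closedBlanket, disIn_an_barren htop hA hi, closedBlanket]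

/-- The barren part of the district of the maximal vertex of an ancestral set is a head. -/
theorem barren_disIn_mem_headsAt (htop : G.IsTopological) (hA : G.IsAncestral A)
    (hi : IsGreatest A i) : G.barren (G.disIn A {i}) ∈ G.headsAt i := by
  have hsub : G.barren (G.disIn A {i}) ⊆ A := (barren_subset _).trans (disIn_subset hi.1)
  have hmem : i ∈ G.barren (G.disIn A {i}) := mem_barren_iff.2 ⟨mem_disIn_self A i,
    fun x hx hix => le_antisymm (hi.2 (disIn_subset hi.1 hx)) (htop.le hix)⟩
  refine ⟨⟨barren_barren _, i, subset_an _ hmem, ?_⟩, hmem, fun x hx => hi.2 (hsub hx)⟩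
  rw [disIn_an_barren htop hA hi.1]
  exact barren_subset _

theorem barren_disIn_an (htop : G.IsTopological) (hH : H ∈ G.headsAt i) :
    G.barren (G.disIn (G.an H) {i}) = H := by
  refine eq_of_an_eq htop (barren_barren _) hH.1.1 (Subset.antisymm
    (an_barren_disIn_subset (isAncestral_an H) (headsAt_mem_an hH)) ?_)
  rw [an_barren htop]
  exact an_mono (headsAt_subset_disIn hH)

theorem isMaximalHead_iff (htop : G.IsTopological) :
    G.IsMaximalHead i H ↔ H = G.barren (G.disIn (Iic i) {i}) := by
  have hmem := barren_disIn_mem_headsAt htop (htop.isAncestral_Iic i) (isGreatest_Iic (a := i))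
  have hmax := isMaximalHead_of_disIn_eq htop hmem
    (disIn_an_barren htop (htop.isAncestral_Iic i) self_mem_Iic).symm
  constructor
  · exact fun h => eq_of_an_eq htop h.1.1.1 hmem.1.1
      (Subset.antisymm (hmax.2 H h.1).2 (h.2 _ hmem).2)
  · rintro rfl
    exact hmax

/-! ### The edges of the refined power DAG -/

/-- A vertex `k` of a barren set `H` is childless in `an(H)`. Deleting it leaves an ancestral set,
in which barren parts can be computed in `G` itself. -/
theorem reaches_singleton_iff (htop : G.IsTopological) {H' : Set V} {k : V} :
    G.Reaches i H {k} H' ↔ H ∈ G.headsAt i ∧ k ∈ H ∧ k ≠ i ∧ G.IsAncestral (G.an H \ {k}) ∧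
      IsGreatest (G.an H \ {k}) i ∧ G.barren (G.disIn (G.an H \ {k}) {i}) = H' := by
  have aux : ∀ H ∈ G.headsAt i, k ∈ H → k ≠ i → G.IsAncestral (G.an H \ {k}) ∧
      IsGreatest (G.an H \ {k}) i := by
    intro H hH hk hki
    refine ⟨(isAncestral_an H).diff_singleton ?_, ⟨headsAt_mem_an hH, hki.symm⟩,
      fun x hx => headsAt_an_subset htop hH hx.1⟩
    rintro y ⟨z, hz, hyz⟩ hky
    have := (mem_barren_iff.1 (hH.1.1.symm ▸ hk : k ∈ G.barren H)).2 z hz (.head hky hyz)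
    subst this
    exact htop.not_dir (htop.le hyz) hky
  constructor
  · rintro ⟨hH, -, -, hk, h⟩
    have hk' := singleton_subset_iff.1 hk
    obtain ⟨h₁, h₂⟩ := aux H hH hk'.1 hk'.2
    rw [h₁.barren_induced (disIn_subset h₂.1)] at h
    exact ⟨hH, hk'.1, hk'.2, h₁, h₂, h⟩
  · rintro ⟨hH, hk, hki, h₁, h₂, h⟩
    refine ⟨hH, h ▸ barren_disIn_mem_headsAt htop h₁ h₂, singleton_nonempty k,
      singleton_subset_iff.2 ⟨hk, hki⟩, ?_⟩
    rwa [h₁.barren_induced (disIn_subset h₂.1)]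

/-- The refined edge into a non-maximal head `H'`: it comes from the largest ancestral set `B` in
which the removal of the childless vertex `k` leaves the district of `H'`. -/
theorem exists_refinedEdge (htop : G.IsTopological) {H' : Set V} (hH' : H' ∈ G.headsAt i)
    (hmax : ¬ G.IsMaximalHead i H') :
    ∃ (B : Set V) (k : V), G.IsAncestral B ∧ IsGreatest B i ∧ k ∈ G.disIn B {i} ∧ k ≠ i ∧
      k ∉ G.closedBlanket i (G.an H') ∧ G.IsAncestral (B \ {k}) ∧
      (∀ A, G.IsAncestral A → IsGreatest A i → G.disIn A {i} = G.disIn (G.an H') {i} →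
        A ⊆ B \ {k}) ∧
      G.RefinedEdge i (G.barren (G.disIn B {i})) k H' := by
  have hiA := headsAt_mem_an hH'
  have hdis := headsAt_disIn hH'
  set D := G.disIn (G.an H') {i} with hD
  have hDA : D ⊆ G.an H' := disIn_subset hiA
  have hham : ∀ y, y ∈ G.ham H' ↔ (∃ x ∈ D, G.bi y x) ∧ y ∉ D := by
    intro y
    rw [ham, hdis]
    rfl
  -- If every vertex of `ham(H')` exceeded `i`, the district of `i` in `[i]` would already be `D`
  -- and `H'` would be maximal.
  have hne : ∃ y ∈ G.ham H', y ≤ i := by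
    by_contra! hcon
    refine hmax (isMaximalHead_of_disIn_eq htop hH' ?_)
    refine disIn_eq_of_closed hiA (hDA.trans (headsAt_an_subset htop hH')) fun x hx y hy hyx => ?_
    by_contra hyD
    exact absurd hy (not_le.2 (hcon y ((hham y).2 ⟨⟨x, hx, hyx⟩, hyD⟩)))
  obtain ⟨y₀, hy₀, hy₀i⟩ := hne
  obtain ⟨k, hk, hkmin⟩ := exists_min_image (G.ham H') id (toFinite _) ⟨y₀, hy₀⟩
  have hkl : IsLeast (G.ham H') k := ⟨hk, fun x hx => hkmin x hx⟩
  have hki : k ≤ i := (hkmin y₀ hy₀).trans hy₀i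
  obtain ⟨⟨x₀, hx₀, hkx₀⟩, hkD⟩ := (hham k).1 hk
  have hiD : i ∈ D := mem_disIn_self _ i
  have hkne : k ≠ i := fun h => hkD (h ▸ hiD)
  -- The largest ancestral set with greatest vertex `i` in which the district of `i` is `D`: the
  -- vertices of `ham(H')` must be excluded, and with them their descendants.
  set A' : Set V := {x | x ≤ i ∧ ∀ h ∈ G.ham H', ¬ Relation.ReflTransGen G.dir h x} with hA'
  have hA'anc : G.IsAncestral A' := isAncestral_iff.2 fun x y hxy hy =>
    ⟨(htop.le (.single hxy)).trans hy.1, fun h hh hhx => hy.2 h hh (hhx.tail hxy)⟩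
  have hkA' : k ∉ A' := fun h => h.2 k hk .refl
  have hBanc : G.IsAncestral (insert k A') := by
    refine isAncestral_iff.2 fun x y hxy hy => ?_
    rcases hy with rfl | hy
    · refine .inr ⟨(htop.le (.single hxy)).trans hki, fun h hh hhx => ?_⟩
      -- A parent of `k` descending from some `h` in `ham(H')` would be at least `h ≥ k`, against
      -- the topological order.
      exact htop.not_dir ((hkl.2 hh).trans (htop.le hhx)) hxy
    · exact .inr (isAncestral_iff.1 hA'anc x y hxy hy)
  have hBk : insert k A' \ {k} = A' := by
    ext x
    simp only [mem_sdiff, mem_insert_iff, mem_singleton_iff]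
    grind
  have hmaxA' : ∀ A, G.IsAncestral A → IsGreatest A i → G.disIn A {i} = D → A ⊆ A' := by
    intro A hA hAi hAD x hx
    refine ⟨hAi.2 hx, fun h hh hhx => ?_⟩
    obtain ⟨⟨z, hz, hhz⟩, hhD⟩ := (hham h).1 hh
    rw [← hAD] at hz hhD
    exact hhD (mem_disIn_of_bi hAi.1 hz (hA.mem_of_reflTransGen hhx hx) hhz)
  have hanA' : G.an H' ⊆ A' := hmaxA' _ (isAncestral_an H')
    ⟨hiA, headsAt_an_subset htop hH'⟩ rfl
  have hdisA' : ∀ C, D ⊆ C → C ⊆ A' → G.disIn C {i} = D := by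
    intro C hDC hCA
    refine disIn_eq_of_closed hiA hDC fun x hx y hy hyx => ?_
    by_contra hyD
    exact (hCA hy).2 y ((hham y).2 ⟨⟨x, hx, hyx⟩, hyD⟩) .refl
  have hBi : IsGreatest (insert k A') i := by
    refine ⟨.inr (hanA' hiA), ?_⟩
    rintro x (rfl | hx)
    · exact hki
    · exact hx.1
  set B := insert k A' with hB
  have hDB : D ⊆ G.disIn B {i} := disIn_mono (hanA'.trans (subset_insert k A')) i
  have hkB : k ∈ G.disIn B {i} := mem_disIn_of_bi hBi.1 (hDB hx₀) (.inl rfl) hkx₀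
  have hBhead := barren_disIn_mem_headsAt htop hBanc hBi
  have hkbar : k ∈ G.barren (G.disIn B {i}) := by
    refine mem_barren_iff.2 ⟨hkB, fun x hx hkx => ?_⟩
    rcases disIn_subset hBi.1 hx with h | h
    · exact h
    · exact absurd hkx (h.2 k hk)
  have hanB : G.an (G.barren (G.disIn B {i})) ⊆ B := an_barren_disIn_subset hBanc hBi.1
  refine ⟨B, k, hBanc, hBi, hkB, hkne, ?_, hBk ▸ hA'anc, hBk ▸ hmaxA', hH', hmax,
    isLeast_ceil htop hkl, ?_, ?_⟩
  · exact fun h => hkA' (hanA' (closedBlanket_subset (isAncestral_an H') hiA h))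
  · refine (reaches_singleton_iff htop).2 ⟨hBhead, hkbar, hkne, ?_, ?_, ?_⟩
    · refine (isAncestral_an _).diff_singleton fun y hy hky => ?_
      rcases hanB hy with rfl | hy'
      · exact G.dir_irrefl _ hky
      · exact hy'.2 k hk (.single hky)
    · exact ⟨⟨headsAt_mem_an hBhead, hkne.symm⟩,
        fun x hx => headsAt_an_subset htop hBhead hx.1⟩
    · rw [hdisA' _ ?_ ?_, hD, barren_disIn_an htop hH']
      · rw [an_barren htop]
        exact fun x hx => ⟨subset_an _ (hDB hx), fun hxk => hkD (hxk ▸ hx)⟩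
      · exact hBk ▸ sdiff_subset_sdiff_left hanB
  -- For any competitor `H`, the district of `i` in `an(H) \ {k}` is `D`, so `an(H) ⊆ B`; then `H`
  -- lies in the district of `i` in `B`.
  · intro H hH
    obtain ⟨hHh, hkH, -, hAanc, hAi, hbar⟩ := (reaches_singleton_iff htop).1 hH
    refine ⟨⟨i, hHh.2, hBhead.2⟩, ?_⟩
    have hAD : G.disIn (G.an H \ {k}) {i} = D := by
      rw [← disIn_an_barren htop hAanc hAi.1, hbar]
    have hHB : G.an H ⊆ B := fun x hx => by
      by_cases hxk : x = k
      · exact .inl hxk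
      · exact .inr (hmaxA' _ hAanc hAi hAD ⟨hx, hxk⟩)
    rw [an_barren htop]
    exact an_mono ((headsAt_subset_disIn hHh).trans (disIn_mono hHB i))

theorem existsUnique_refinedEdge (htop : G.IsTopological) {H' : Set V} (hH' : H' ∈ G.headsAt i)
    (hmax : ¬ G.IsMaximalHead i H') : ∃! e : Set V × V, G.RefinedEdge i e.1 e.2 H' := by
  obtain ⟨B, k, -, -, -, -, -, -, -, h⟩ := exists_refinedEdge htop hH' hmax
  exact ⟨(_, k), h, fun e he => Prod.ext_iff.2 (refinedEdge_unique htop he h)⟩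

end HeadsAt

/-! ### The equivalence of the two lists -/

theorem refinedListAt_fst_eq (htop : G.IsTopological) (i : V) :
    (⟨{i}, Iio i \ G.mb i (Iic i), G.mb i (Iic i)⟩ : CIStatement V) =
      G.localIndep i (Iic i) := by
  rw [← localIndep_eq (htop.isAncestral_Iic i) self_mem_Iic, ← sdiff_sdiff, ← sdiff_sdiff_comm,
    Iic_sdiff_right]

/-- Double induction: upwards on `i`, and for fixed `i` downwards on `A`, since the refined edge
into the head of `A` starts from a strictly larger set `B`. -/
theorem localIndep_of_refinedList [Finite V] (htop : G.IsTopological) (hM : IsSemigraphoid M)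
    (hR : G.refinedList ⊆ M) (i : V) :
    ∀ A, G.IsAncestral A → IsGreatest A i → G.localIndep i A ∈ M := by
  have : WellFoundedLT V := Finite.to_wellFoundedLT
  induction i using WellFoundedLT.induction with
  | _ i ihi =>
    intro A
    induction A using WellFoundedGT.induction with
    | _ A ihA =>
      intro hA hAi
      have hHh := barren_disIn_mem_headsAt htop hA hAi
      have hN := closedBlanket_an_barren htop hA hAi.1
      have hD := disIn_an_barren htop hA hAi.1
      have hiN := mem_closedBlanket_self (G := G) i A
      by_cases hmax : G.IsMaximalHead i (G.barren (G.disIn A {i}))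
      -- A maximal head means that `i` has the same blanket in `A` as in `[i]`.
      · have hmem : G.localIndep i (Iic i) ∈ M := by
          rw [← refinedListAt_fst_eq htop]
          exact hR (mem_iUnion.2 ⟨i, .inl rfl⟩)
        have hII := htop.isAncestral_Iic i
        have hN' := closedBlanket_an_barren htop hII self_mem_Iic
        rw [← (isMaximalHead_iff htop).1 hmax, hN] at hN'
        unfold localIndep at hmem ⊢
        rw [← hN'] at hmem
        refine hM.mono_right ?_ ?_ ?_ (sdiff_subset_sdiff_left hAi.2) hmem
        · exact disjoint_singleton_left.2 fun h => h.2 hiN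
        · simp
        · exact disjoint_left.2 fun x hx hx' => hx.2 hx'.1
      · obtain ⟨B, k, hB, hBi, hkB, hki, hkN, hBk, hmaxB, hedge⟩ :=
          exists_refinedEdge htop hHh hmax
        have hAB := hmaxB A hA hAi hD.symm
        have hkBm : k ∈ B := disIn_subset hBi.1 hkB
        have hlt : A < B := (ssubset_iff_of_subset (hAB.trans sdiff_subset)).2
          ⟨k, hkBm, fun h => (hAB h).2 rfl⟩
        have hiB := ihA B hlt hB hBi
        have hic : ∀ y ∈ B, ¬ G.dir i y := fun y hy => htop.not_dir (hBi.2 hy)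
        have hkc : ∀ y ∈ B, ¬ G.dir k y := by
          intro y hy hky
          by_cases hyk : y = k
          · exact G.dir_irrefl k (hyk ▸ hky)
          · exact (isAncestral_iff.1 hBk k y hky ⟨hy, hyk⟩).2 rfl
        -- All vertices of `B \ {i}` are below `i`, so the induction on `i` covers its ancestral
        -- subsets; `k` is childless there but need not be greatest.
        have hkM : G.localIndep k (B \ {i}) ∈ M := by
          refine localIndep_of_forall_isGreatest htop hM _ _ rfl (hB.diff_singleton hic) ?_ k
            ⟨hkBm, hki⟩ fun y hy => hkc y hy.1
          intro C hC hCa j hj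
          exact ihi j (lt_of_le_of_ne (hBi.2 (hC hj.1).1) (hC hj.1).2) C hCa hj
        -- The vertex `k` disappears from the conditioning set, which becomes `(N' \ (N ∪ {k})) ∪ (N
        -- \ {i})`, as contraction requires.
        have h₁ := (localIndep_pair hM hB hkBm hki hic (mem_disIn_symm hkB) hkM hiB).1
        have h₂ : G.edgeIndep i (G.barren (G.disIn B {i})) {k} (G.barren (G.disIn A {i})) ∈ M :=
          hR (mem_iUnion.2 ⟨i, .inr ⟨_, _, _, hedge, rfl⟩⟩)
        rw [edgeIndep, headsAt_union_tail hHh,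
          headsAt_union_tail (barren_disIn_mem_headsAt htop hB hBi),
          closedBlanket_an_barren htop hB hBi.1, hN] at h₂
        rw [hN] at hkN
        have hNB := closedBlanket_mono (G := G) (hAB.trans sdiff_subset) i
        have hkNB : k ∈ G.closedBlanket i B := .inl hkB
        unfold localIndep
        set N := G.closedBlanket i A
        set N' := G.closedBlanket i B
        have h₃ := hM.contraction {i} (N' \ (N ∪ {k})) (B \ N') (N \ {i})
          (by simp [hiN]) (by simp [hNB hiN]) (by simp)
          (disjoint_left.2 fun x hx hx' => hx'.2 hx.1)
          (disjoint_left.2 fun x hx hx' => hx.2 (.inl hx'.1))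
          (disjoint_left.2 fun x hx hx' => hx.2 (hNB hx'.1)) h₂ (by
            convert h₁ using 2
            ext x
            simp only [mem_sdiff, mem_singleton_iff, mem_union, mem_insert_iff]
            grind)
        refine hM.mono_right ?_ ?_ ?_ ?_ h₃
        · simp [hiN, hNB hiN]
        · simp
        · refine disjoint_left.2 ?_
          rintro x (hx | hx) hx'
          · exact hx.2 (.inl hx'.1)
          · exact hx.2 (hNB hx'.1)
        -- The only vertex of `B \ N` missing on the right is `k`, and `k ∉ A`.
        · intro x hx
          have := hAB hx.1
          simp only [mem_sdiff, mem_singleton_iff, mem_union] at this hx ⊢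
          grind

theorem refinedList_subset_iff [Finite V] (htop : G.IsTopological) (hM : IsSemigraphoid M) :
    G.refinedList ⊆ M ↔ G.orderedLocal ⊆ M := by
  rw [orderedLocal_subset_iff]
  constructor
  · exact fun hR A v hA hv hvc => localIndep_of_forall_isGreatest htop hM _ A rfl hA
      (fun B _ hB i hi => localIndep_of_refinedList htop hM hR i B hB hi) v hv hvc
  · intro h s hs
    obtain ⟨i, hs⟩ := mem_iUnion.1 hs
    rcases hs with rfl | ⟨H, k, H', hedge, rfl⟩
    · rw [refinedListAt_fst_eq htop]
      exact h _ _ (htop.isAncestral_Iic i) self_mem_Iic fun y hy => htop.not_dir hy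
    · obtain ⟨hH', -, -, hr, -⟩ := hedge
      obtain ⟨hH, hk, hki, hA, hAi, hbar⟩ := (reaches_singleton_iff htop).1 hr
      have hmem := h _ i hA hAi.1 fun y hy => htop.not_dir (hAi.2 hy)
      -- The blanket of `i` in `an(H) \ {k}` is `H' ∪ tail(H')`, so the independence of the edge is
      -- part of the local independence there.
      have hN := closedBlanket_an_barren htop hA hAi.1
      rw [hbar] at hN
      rw [edgeIndep, headsAt_union_tail hH, headsAt_union_tail hH', hN]
      have hiN := mem_closedBlanket_self (G := G) i (G.an H \ {k})
      refine hM.mono_right ?_ ?_ ?_ ?_ hmem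
      · simp [hiN]
      · simp
      · exact disjoint_left.2 fun x hx hx' => hx.2 hx'.1
      · intro x hx
        have := closedBlanket_subset (isAncestral_an H) (headsAt_mem_an hH) hx.1
        exact ⟨⟨this, fun hxk => hx.2 (.inr hxk)⟩, fun hxN => hx.2 (.inl hxN)⟩

/-! ### Counting independences by heads -/

theorem encard_refinedList_le [Finite V] (htop : G.IsTopological) :
    G.refinedList.encard ≤ G.heads.encard := by
  have hex : ∀ H : Set V, ∃ s : CIStatement V, ∀ i,
      (G.IsMaximalHead i H → s = ⟨{i}, Iio i \ G.mb i (Iic i), G.mb i (Iic i)⟩) ∧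
      ∀ Hs k, G.RefinedEdge i Hs k H → s = G.edgeIndep i Hs {k} H := by
    intro H
    by_cases h : ∃ i, G.IsMaximalHead i H
    · obtain ⟨i, hi⟩ := h
      refine ⟨⟨{i}, Iio i \ G.mb i (Iic i), G.mb i (Iic i)⟩,
        fun j => ⟨fun hj => ?_, fun Hs k hk => ?_⟩⟩
      · rw [hi.1.2.unique hj.1.2]
      · rw [hi.1.2.unique hk.1.2] at hi
        exact absurd hi hk.2.1
    · by_cases h' : ∃ i Hs k, G.RefinedEdge i Hs k H
      · obtain ⟨i, Hs, k, hk⟩ := h'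
        refine ⟨G.edgeIndep i Hs {k} H, fun j => ⟨fun hj => absurd ⟨j, hj⟩ h, ?_⟩⟩
        intro Hs' k' hk'
        obtain rfl := hk.1.2.unique hk'.1.2
        obtain ⟨rfl, rfl⟩ := refinedEdge_unique htop hk hk'
        rfl
      -- An arbitrary value, for sets that index no statement.
      · exact ⟨⟨∅, ∅, ∅⟩, fun j => ⟨fun hj => absurd ⟨j, hj⟩ h,
          fun Hs k hk => absurd ⟨j, Hs, k, hk⟩ h'⟩⟩
  choose f hf using hex
  refine (encard_le_encard ?_).trans (encard_image_le f G.heads)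
  intro s hs
  obtain ⟨i, hs⟩ := mem_iUnion.1 hs
  rcases hs with rfl | ⟨H, k, H', hedge, rfl⟩
  · have hm := (isMaximalHead_iff htop (i := i)).2 rfl
    exact ⟨_, hm.1.1, (hf _ i).1 hm⟩
  · exact ⟨H', hedge.1.1, (hf H' i).2 H k hedge⟩

end MixedGraph

/-- For a MAG with a topological order of its vertices: the refined list is equivalent to the
ordered local Markov property, for every distribution and also under the semi-graphoid axioms
alone; the refined power DAGs have exactly one edge into each non-maximal head; and the refined
list has at most as many independences as there are heads. -/
theorem mainTheorem7 {V : Type*} [Finite V] [LinearOrder V] (G : MixedGraph V)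
    (hG : G.IsMAG) (htop : G.IsTopological) :
    (∀ (Ω : Type*) [MeasurableSpace Ω] (P : Measure Ω) [IsProbabilityMeasure P]
        (E : V → Type*) [∀ v, MeasurableSpace (E v)] (X : ∀ v, Ω → E v),
        (∀ v, Measurable (X v)) →
        (SatisfiesList P X G.refinedList ↔ SatisfiesList P X G.orderedLocal)) ∧
    (∀ M : Set (CIStatement V), IsSemigraphoid M →
        (G.refinedList ⊆ M ↔ G.orderedLocal ⊆ M)) ∧
    (∀ i, ∀ H' ∈ G.headsAt i, ¬ G.IsMaximalHead i H' →
        ∃! e : Set V × V, G.RefinedEdge i e.1 e.2 H') ∧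
    G.refinedList.encard ≤ G.heads.encard := by
  refine ⟨?_, fun M hM => MixedGraph.refinedList_subset_iff htop hM,
    fun i H' hH' hmax => MixedGraph.existsUnique_refinedEdge htop hH' hmax,
    MixedGraph.encard_refinedList_le htop⟩
  intro Ω _ P _ E _ X hX
  exact MixedGraph.refinedList_subset_iff htop (isSemigraphoid_condIndepVars hX)
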